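/- Let $X=(X_1,\ldots,X_d)$ be a random vector in $\mathbb{R}^d$ with joint distribution function $F$ and marginal distribution functions $F_1,\ldots,F_d$ (not necessarily continuous), and let $C$ be a copula of $F$, that is, a probability distribution function on $[0,1]^d$ with uniform margins such that $F(x)=C(F_1(x_1),\ldots,F_d(x_d))$ for all $x\in\mathbb{R}^d$. Let $G(t):=\mathrm{P}(X_1+\cdots+X_d\le t)$, $t\in\mathbb{R}$. On a probability space $(\Omega,\mathcal{A},\mathrm{P})$, let $X_i^{(k)}$, $i=1,\ldots,d$, $k\ge1$, be real random variables (not assumed i.i.d.), and let $U^{(1)},U^{(2)},\ldots$ be i.i.d. random vectors with distribution $C$; no assumption is made on the dependence between the $X_i^{(k)}$ or between them and the $U^{(k)}$. For $n\ge1$ put $$F_{i,n}(t):=\frac1n\sum_{k=1}^n 1\{X_i^{(k)}\le t\},\qquad R_i^{(j)}:=\sum_{k=1}^n 1\{U_i^{(j)}\ge U_i^{(k)}\},$$ let $X_i^{(1:n)}\le\cdots\le X_i^{(n:n)}$ be the order statistics of $X_i^{(1)},\ldots,X_i^{(n)}$, and define the Iman–Conover estimator of $G$ by $$G_n^\ast(t):=\frac1n\sum_{k=1}^n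 1\left\{X_1^{(R_1^{(k)}:n)}+\cdots+X_d^{(R_d^{(k)}:n)}\le t\right\},\qquad t\in\mathbb{R}.$$ Write $\|f\|_\infty:=\sup_{t\in\mathbb{R}}|f(t)|$. Suppose that, as $n\to\infty$, $\|F_{i,n}-F_i\|_\infty\to0$ $\mathrm{P}$-almost surely for each $i=1,\ldots,d$, and that $C$ is absolutely continuous with respect to Lebesgue measure. Then $\|G_n^\ast-G\|_\infty\to0$ $\mathrm{P}$-almost surely. -/

import Mathlib

open MeasureTheory ProbabilityTheory Filter Topology

noncomputable section

namespace ImanConover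

/-- The uniform norm `‖f‖_∞ = sup_t |f t|` (used only for differences of functions with values in
`[0, 1]`, so that the supremum is taken over a bounded set). -/
def supNorm (f : ℝ → ℝ) : ℝ := ⨆ t : ℝ, |f t|

/-- The joint distribution function `F(x) = μ((-∞, x_1] × ⋯ × (-∞, x_d])` of a law `μ` on `ℝ^d`. -/
def jointCDF {d : ℕ} (μ : Measure (Fin d → ℝ)) (x : Fin d → ℝ) : ℝ :=
  μ.real {y | ∀ i, y i ≤ x i}

/-- The `i`-th marginal distribution function `F_i(t) = P(X_i ≤ t)`, for `X ∼ μ`. -/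
def marginCDF {d : ℕ} (μ : Measure (Fin d → ℝ)) (i : Fin d) (t : ℝ) : ℝ :=
  μ.real {y | y i ≤ t}

/-- The distribution function `G(t) = P(X_1 + ⋯ + X_d ≤ t)` of the component sum, for `X ∼ μ`. -/
def sumCDF {d : ℕ} (μ : Measure (Fin d → ℝ)) (t : ℝ) : ℝ :=
  μ.real {y | ∑ i, y i ≤ t}

/-- `C` is (the probability measure `P_C` of) a copula: a probability measure
all of whose margins are uniform on `[0, 1]`. The copula as a function is `jointCDF C`. -/
structure IsCopula {d : ℕ} (C : Measure (Fin d → ℝ)) : Prop where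
  isProbabilityMeasure : IsProbabilityMeasure C
  map_eval : ∀ i, C.map (fun u => u i) = volume.restrict (Set.Icc (0 : ℝ) 1)

/-- `C` is a copula of the law `μ`: `F(x) = C(F_1(x_1), …, F_d(x_d))` for all `x`. -/
structure IsCopulaOf {d : ℕ} (C μ : Measure (Fin d → ℝ)) : Prop where
  isCopula : IsCopula C
  sklar : ∀ x : Fin d → ℝ, jointCDF μ x = jointCDF C (fun i => marginCDF μ i (x i))

/-- The empirical distribution function `n⁻¹ ∑_k 1{x_k ≤ t}` of a univariate sample. -/
def empiricalCDF {n : ℕ} (x : Fin n → ℝ) (t : ℝ) : ℝ :=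
  (1 / (n : ℝ)) * ∑ k, if x k ≤ t then 1 else 0

/-- The rank `∑_k 1{v_j ≥ v_k}` of `v_j` in the sample `v`; it lies in `{1, …, n}`. -/
def rank {n : ℕ} (v : Fin n → ℝ) (j : Fin n) : ℕ :=
  ∑ k, if v j ≥ v k then 1 else 0

theorem rank_pos {n : ℕ} (v : Fin n → ℝ) (j : Fin n) : 1 ≤ rank v j := by
  have h := Finset.single_le_sum (f := fun k => if v j ≥ v k then 1 else 0)
    (fun k _ => Nat.zero_le _) (Finset.mem_univ j)
  simpa [rank] using h

theorem rank_le {n : ℕ} (v : Fin n → ℝ) (j : Fin n) : rank v j ≤ n := by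
  have h : rank v j ≤ ∑ _k : Fin n, 1 :=
    Finset.sum_le_sum fun k _ => by split_ifs <;> simp
  simpa using h

/-- The order statistic `x^{(r:n)}`, `1 ≤ r ≤ n`: the `r`-th entry of the sample `x` sorted in
non-decreasing order. -/
def orderStat {n : ℕ} (x : Fin n → ℝ) (r : ℕ) (h₁ : 1 ≤ r) (h₂ : r ≤ n) : ℝ :=
  x (Tuple.sort x ⟨r - 1, by omega⟩)

/-- The synthetic multivariate sample `(x_1^{(R_1^{(j)}:n)}, …, x_d^{(R_d^{(j)}:n)})`,
`j = 1, …, n`: the marginal samples `x i` reordered by the marginal ranks of `u`. -/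
def syntheticSample {d n : ℕ} (x : Fin d → Fin n → ℝ) (u : Fin n → Fin d → ℝ)
    (j : Fin n) (i : Fin d) : ℝ :=
  orderStat (x i) (rank (fun k => u k i) j) (rank_pos _ j) (rank_le _ j)

/-- The Iman–Conover estimator `G_n^*` of the distribution function of the component sum: the
empirical distribution function of the component sums of the synthetic sample. -/
def sumEstimator {d n : ℕ} (x : Fin d → Fin n → ℝ) (u : Fin n → Fin d → ℝ) (t : ℝ) : ℝ :=
  empiricalCDF (fun j => ∑ i, syntheticSample x u j i) t

end ImanConover

end

open MeasureTheory ProbabilityTheory Filter Topology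

/-! Everything is read off lower sets of the unit cube. By Sklar's relation, `G t` is the `C`-mass
of the lower set `sumRegion μ t`. The `j`-th synthetic sum is at most `t` exactly when the vector of
scaled ranks of `u j` lies in the analogous set built from the empirical margins
(`sum_syntheticSample_le_iff`). Scaled ranks are close to `u j`, and empirical margins are uniformly
close to `F_i`, so this event lies between the events that `u j` is in `sumRegion μ t` shifted down
or up the diagonal by a small `h`.

Two facts then finish the proof, both uniform over lower sets and hence over `t`. A diagonal shift
by `h` adds little `C`-mass, by absolute continuity (`IsCopula.exists_shift`). Frequencies of lower
sets converge to their `C`-mass (`IsCopula.glivenkoCantelli`), by the strong law on finitely many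
grid cells and the same shift bound. Dependence among the `X` or between `X` and `U` plays no role,
since the comparison is made pathwise. -/

namespace ImanConover

/-! ### Relative frequencies and the strong law of large numbers -/

section Frequency

variable {E : Type*}

/-- The relative frequency with which the first `n` terms of `u` lie in `A`. -/
noncomputable def freq (n : ℕ) (u : ℕ → E) (A : Set E) : ℝ :=
  (∑ k ∈ Finset.range n, A.indicator (fun _ => (1 : ℝ)) (u k)) / n

theorem freq_mono {n : ℕ} {u : ℕ → E} {A B : Set E} (h : ∀ k < n, u k ∈ A → u k ∈ B) :
    freq n u A ≤ freq n u B := by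
  refine div_le_div_of_nonneg_right (Finset.sum_le_sum fun k hk => ?_) (Nat.cast_nonneg n)
  by_cases hA : u k ∈ A
  · simp [hA, h k (Finset.mem_range.1 hk) hA]
  · rw [Set.indicator_of_notMem hA]
    exact Set.indicator_nonneg (fun _ _ => zero_le_one) _

theorem ae_tendsto_freq {Ω : Type*} [MeasurableSpace Ω] {P : Measure Ω} [IsProbabilityMeasure P]
    [MeasurableSpace E] {C : Measure E} {U : ℕ → Ω → E} (hU : ∀ k, Measurable (U k))
    (hUlaw : ∀ k, P.map (U k) = C) (hUindep : iIndepFun U P) {A : Set E} (hA : MeasurableSet A) :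
    ∀ᵐ ω ∂P, Tendsto (fun n => freq n (fun k => U k ω) A) atTop (𝓝 (C.real A)) := by
  have hm : Measurable (A.indicator (fun _ => (1 : ℝ))) := measurable_const.indicator hA
  have hint : Integrable (fun ω => A.indicator (fun _ => (1 : ℝ)) (U 0 ω)) P := by
    have : (fun ω => A.indicator (fun _ => (1 : ℝ)) (U 0 ω))
        = (U 0 ⁻¹' A).indicator (fun _ => (1 : ℝ)) := by
      rfl
    rw [this]
    exact (integrable_const 1).indicator (hU 0 hA)
  have h := strong_law_ae_real (μ := P) (fun k ω => A.indicator (fun _ => (1 : ℝ)) (U k ω)) hint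
    (fun i j hij => (hUindep.indepFun hij).comp hm hm)
    (fun i => IdentDistrib.comp ⟨(hU i).aemeasurable, (hU 0).aemeasurable, by
      rw [hUlaw, hUlaw]⟩ hm)
  have hval : ∫ ω, A.indicator (fun _ => (1 : ℝ)) (U 0 ω) ∂P = C.real A := by
    rw [← integral_map (φ := U 0) (f := A.indicator (fun _ => (1 : ℝ))) (hU 0).aemeasurable
      hm.aestronglyMeasurable, hUlaw, integral_indicator hA]
    simp
  rw [hval] at h
  exact h

end Frequency

/-! ### Lower sets under an absolutely continuous copula -/

section Copula

variable {d : ℕ} {C μ : Measure (Fin d → ℝ)}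

theorem IsCopula.map_apply (hC : IsCopula C) (i : Fin d) {S : Set ℝ} (hS : MeasurableSet S) :
    C {u | u i ∈ S} = volume (S ∩ Set.Icc 0 1) := by
  rw [← Measure.restrict_apply hS, ← hC.map_eval i, Measure.map_apply (measurable_pi_apply i) hS]
  rfl

theorem IsCopula.ae_mem_Ioo (hC : IsCopula C) : ∀ᵐ u ∂C, ∀ i, u i ∈ Set.Ioo (0 : ℝ) 1 := by
  rw [ae_all_iff]
  intro i
  rw [ae_iff]
  have := hC.map_apply i (S := (Set.Ioo (0 : ℝ) 1)ᶜ) measurableSet_Ioo.compl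
  refine this.trans ?_
  refine measure_mono_null (t := {0, 1}) ?_ (Set.Finite.measure_zero (by simp) _)
  rintro x ⟨h1, h2, h3⟩
  simp only [Set.mem_compl_iff, Set.mem_Ioo, not_and, not_lt] at h1
  rcases h2.eq_or_lt with h | h
  · simp [← h]
  · simp [le_antisymm h3 (h1 h)]

theorem IsCopula.ae_mem_Icc (hC : IsCopula C) : ∀ᵐ u ∂C, u ∈ Set.Icc (0 : Fin d → ℝ) 1 := by
  filter_upwards [hC.ae_mem_Ioo] with u hu
  exact ⟨fun i => (hu i).1.le, fun i => (hu i).2.le⟩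

theorem IsCopula.real_eval_le (hC : IsCopula C) (i : Fin d) {s : ℝ} (hs : s ∈ Set.Icc (0 : ℝ) 1) :
    C.real {u | u i ≤ s} = s := by
  have h := hC.map_apply i (S := Set.Iic s) measurableSet_Iic
  have h2 : Set.Iic s ∩ Set.Icc (0 : ℝ) 1 = Set.Icc 0 s := by
    ext x
    simp only [Set.mem_inter_iff, Set.mem_Iic, Set.mem_Icc]
    exact ⟨fun h => ⟨h.2.1, h.1⟩, fun h => ⟨h.2, h.1, h.2.trans hs.2⟩⟩
  rw [h2, Real.volume_Icc, sub_zero] at h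
  change (C {u | u i ∈ Set.Iic s}).toReal = s
  rw [h, ENNReal.toReal_ofReal hs.1]

/-- Inside the cube, a point of the raised set either dominates `c`, and then lies in a translate of
`L ∩ [0,1]^d`, which has the same volume, or lies in the cube minus `[c,1]`, of volume `1 - (1 -
h)^d`. Lower sets need not be Borel, but being order connected they are Lebesgue null-measurable. -/
theorem volume_shift_diff_le {L : Set (Fin d → ℝ)} (hL : IsLowerSet L) {h : ℝ} (h0 : 0 ≤ h)
    (h1 : h ≤ 1) :
    volume (({u | u - (fun _ => h) ∈ L} \ L) ∩ Set.Icc 0 1) ≤ ENNReal.ofReal (1 - (1 - h) ^ d) := by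
  set c : Fin d → ℝ := fun _ => h with hc
  have hc0 : 0 ≤ c := fun _ => h0
  have hbox : volume (Set.Icc (0 : Fin d → ℝ) 1) = 1 := by
    rw [Real.volume_Icc_pi]; simp
  have hsub : volume (Set.Icc c 1) = ENNReal.ofReal ((1 - h) ^ d) := by
    rw [Real.volume_Icc_pi, ENNReal.ofReal_pow (by linarith)]; simp [hc]
  have hdiff : volume (Set.Icc (0 : Fin d → ℝ) 1 \ Set.Icc c 1) ≤ ENNReal.ofReal (1 - (1 - h) ^ d) := by
    rw [measure_sdiff (Set.Icc_subset_Icc_left hc0) measurableSet_Icc.nullMeasurableSet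
      (by rw [hsub]; exact ENNReal.ofReal_ne_top), hbox, hsub,
      ENNReal.ofReal_sub _ (by have : 0 ≤ 1 - h := by linarith
                               positivity), ENNReal.ofReal_one]
  have hLn : NullMeasurableSet (L ∩ Set.Icc 0 1) volume :=
    hL.ordConnected.nullMeasurableSet.inter measurableSet_Icc.nullMeasurableSet
  have hsubset : L ∩ Set.Icc 0 1 ⊆ {u | u - c ∈ L} ∩ Set.Icc 0 1 := fun u hu =>
    ⟨hL (sub_le_self u hc0) hu.1, hu.2⟩
  have hfin : volume (L ∩ Set.Icc 0 1) ≠ ⊤ :=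
    ((measure_mono Set.inter_subset_right).trans_lt (by rw [hbox]; simp)).ne
  have hmain : volume ({u | u - c ∈ L} ∩ Set.Icc 0 1)
      ≤ volume (L ∩ Set.Icc 0 1) + ENNReal.ofReal (1 - (1 - h) ^ d) := by
    have hcov : {u | u - c ∈ L} ∩ Set.Icc 0 1
        ⊆ ((fun u => u - c) ⁻¹' (L ∩ Set.Icc 0 1)) ∪ (Set.Icc (0 : Fin d → ℝ) 1 \ Set.Icc c 1) := by
      rintro u ⟨hu, hu2⟩
      by_cases hcu : c ≤ u
      · exact Or.inl ⟨hu, sub_nonneg.2 hcu, (sub_le_self u hc0).trans hu2.2⟩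
      · exact Or.inr ⟨hu2, fun h => hcu h.1⟩
    refine (measure_mono hcov).trans ((measure_union_le _ _).trans (add_le_add ?_ hdiff))
    simp_rw [sub_eq_add_neg]
    exact (measure_preimage_add_right volume (-c) _).le
  have heq : ({u | u - c ∈ L} \ L) ∩ Set.Icc 0 1
      = ({u | u - c ∈ L} ∩ Set.Icc 0 1) \ (L ∩ Set.Icc 0 1) := by
    ext u; simp only [Set.mem_inter_iff, Set.mem_sdiff]; tauto
  rw [heq, measure_sdiff hsubset hLn hfin]
  exact tsub_le_iff_left.2 hmain

/-- The volume bound does not depend on `L`, and integrability of the density turns small volume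
into small `C`-mass; so one `h` serves all lower sets. -/
theorem IsCopula.exists_shift (hC : IsCopula C) (hCac : C ≪ volume) {η : ℝ} (hη : 0 < η) :
    ∃ h > 0, ∀ L : Set (Fin d → ℝ), IsLowerSet L →
      C.real {u | u - (fun _ => h) ∈ L} ≤ C.real L + η := by
  have := hC.isProbabilityMeasure
  obtain ⟨δ, hδ, hδC⟩ := exists_pos_setLIntegral_lt_of_measure_lt
    (μ := (volume : Measure (Fin d → ℝ))) (f := C.rnDeriv volume)
    (Measure.lintegral_rnDeriv_lt_top C volume).ne (ENNReal.ofReal_pos.2 hη).ne'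
  have htend : Tendsto (fun h : ℝ => ENNReal.ofReal (1 - (1 - h) ^ d)) (𝓝[>] 0) (𝓝 0) := by
    have : Continuous fun h : ℝ => ENNReal.ofReal (1 - (1 - h) ^ d) :=
      ENNReal.continuous_ofReal.comp (by fun_prop)
    simpa using (this.tendsto 0).mono_left nhdsWithin_le_nhds
  obtain ⟨h, ⟨hlt, h1⟩, h0⟩ := ((((tendsto_order.1 htend).2 δ hδ).and
    (nhdsWithin_le_nhds (Iic_mem_nhds (zero_lt_one' ℝ)))).and self_mem_nhdsWithin).exists
  have h0 : 0 < h := h0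
  refine ⟨h, h0, fun L hL => ?_⟩
  set D := ({u | u - (fun _ => h) ∈ L} \ L) ∩ Set.Icc 0 1 with hD
  have hv : volume D < δ := (volume_shift_diff_le hL h0.le h1).trans_lt hlt
  have hCD : C D ≤ ENNReal.ofReal η := by
    have hlt := hδC D hv
    rw [← Measure.setLIntegral_rnDeriv hCac]
    exact hlt.le
  have hcov : C {u | u - (fun _ => h) ∈ L} ≤ C L + C D := by
    refine le_trans ?_ (measure_union_le _ _)
    refine measure_mono_ae ?_
    filter_upwards [hC.ae_mem_Icc] with u hu hL'
    by_cases hm : u ∈ L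
    · exact Or.inl hm
    · exact Or.inr ⟨⟨hL', hm⟩, hu⟩
  have hfin : C L + C D ≠ ⊤ := by simp
  have := ENNReal.toReal_mono hfin hcov
  rw [ENNReal.toReal_add (by simp) (by simp)] at this
  exact this.trans (add_le_add le_rfl (ENNReal.toReal_le_of_le_ofReal hη.le hCD))

/-- The cell of the grid of mesh `1 / m` that contains `u ∈ [0, 1]^d`. -/
noncomputable def gridCell (m : ℕ) (u : Fin d → ℝ) (i : Fin d) : Fin (m + 1) :=
  Fin.ofNat (m + 1) ⌊m * u i⌋₊

theorem measurable_gridCell (m : ℕ) : Measurable (gridCell m : (Fin d → ℝ) → Fin d → Fin (m + 1)) := by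
  refine measurable_pi_lambda _ fun i => ?_
  refine (measurable_of_countable (fun k : ℕ => Fin.ofNat (m + 1) k)).comp ?_
  exact Nat.measurable_floor.comp ((measurable_pi_apply i).const_mul _)

theorem sub_le_of_gridCell_eq {m : ℕ} {h : ℝ} (hm : 1 ≤ m * h) {u v : Fin d → ℝ}
    (hu : u ∈ Set.Icc 0 1) (hv : v ∈ Set.Icc 0 1) (huv : gridCell m u = gridCell m v) :
    u - (fun _ => h) ≤ v := by
  intro i
  have key : ∀ w : Fin d → ℝ, w ∈ Set.Icc 0 1 → ((gridCell m w i : Fin (m + 1)) : ℕ) = ⌊m * w i⌋₊ := by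
    intro w hw
    -- On the cube the floor is at most `m`, with `m` itself attained at coordinate `1`, so
    -- reduction modulo `m + 1` changes nothing.
    refine Nat.mod_eq_of_lt (Nat.lt_succ_of_le (Nat.floor_le_of_le ?_))
    have := hw.2 i
    simp only [Pi.one_apply] at this
    nlinarith [Nat.cast_nonneg (α := ℝ) m]
  have hfl : ⌊m * u i⌋₊ = ⌊m * v i⌋₊ := by rw [← key u hu, ← key v hv, huv]
  have h1 := Nat.lt_floor_add_one ((m : ℝ) * u i)
  have hv0 : 0 ≤ v i := hv.1 i
  have h2 := Nat.floor_le (a := (m : ℝ) * v i) (by positivity)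
  rw [hfl] at h1
  have hm0 : (0 : ℝ) < m := by
    rcases Nat.eq_zero_or_pos m with h | h
    · simp [h] at hm; linarith
    · exact_mod_cast h
  have : (m : ℝ) * (u i - h) ≤ m * v i := by linarith
  exact le_of_mul_le_mul_left this hm0

/-- **Glivenko–Cantelli theorem** over all lower sets, for absolutely continuous copulas. -/
theorem IsCopula.glivenkoCantelli (hC : IsCopula C) (hCac : C ≪ volume)
    {Ω : Type*} [MeasurableSpace Ω] {P : Measure Ω} [IsProbabilityMeasure P]
    {U : ℕ → Ω → Fin d → ℝ} (hU : ∀ k, Measurable (U k))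
    (hUlaw : ∀ k, P.map (U k) = C) (hUindep : iIndepFun U P) :
    ∀ᵐ ω ∂P, ∀ η > 0, ∀ᶠ n in atTop, ∀ L : Set (Fin d → ℝ), IsLowerSet L →
      |freq n (fun k => U k ω) L - C.real L| ≤ η := by
  have := hC.isProbabilityMeasure
  have hcells : ∀ᵐ ω ∂P, ∀ (m : ℕ) (B : Set (Fin d → Fin (m + 1))),
      Tendsto (fun n => freq n (fun k => U k ω) (gridCell m ⁻¹' B)) atTop
        (𝓝 (C.real (gridCell m ⁻¹' B))) := by
    simp_rw [ae_all_iff]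
    intro m B
    exact ae_tendsto_freq hU hUlaw hUindep (measurable_gridCell m (Set.toFinite B).measurableSet)
  have hbox : ∀ᵐ ω ∂P, ∀ k, U k ω ∈ Set.Icc (0 : Fin d → ℝ) 1 := by
    rw [ae_all_iff]
    intro k
    exact ae_of_ae_map (hU k).aemeasurable (by rw [hUlaw]; exact hC.ae_mem_Icc)
  filter_upwards [hcells, hbox] with ω hω hbω η hη
  obtain ⟨h, h0, hshift⟩ := hC.exists_shift hCac (half_pos hη)
  obtain ⟨m, hm⟩ := exists_nat_ge (1 / h)
  have hmh : 1 ≤ m * h := by rwa [div_le_iff₀ h0] at hm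
  have hev : ∀ᶠ n in atTop, ∀ B : Set (Fin d → Fin (m + 1)),
      |freq n (fun k => U k ω) (gridCell m ⁻¹' B) - C.real (gridCell m ⁻¹' B)| < η / 2 := by
    rw [eventually_all]
    intro B
    have := Metric.tendsto_nhds.1 (hω m B) (η / 2) (half_pos hη)
    simpa only [Real.dist_eq] using this
  filter_upwards [hev] with n hn L hL
  rw [abs_le]
  constructor
  -- Lower bound: lower `L` by `h`; every grid cell that meets the lowered set stays inside `L`
  -- within the cube.
  · set L' : Set (Fin d → ℝ) := {u | u + (fun _ => h) ∈ L} with hL'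
    have hlow : IsLowerSet L' := fun u v hvu hu => hL (add_le_add_left hvu _) hu
    have e1 := hshift L' hlow
    have e0 : {u | u - (fun _ => h) ∈ L'} = L := by ext u; simp [hL']
    rw [e0] at e1
    set A := gridCell m ⁻¹' (gridCell m '' (L' ∩ Set.Icc 0 1)) with hA
    have e2 : C.real L' ≤ C.real A := by
      refine ENNReal.toReal_mono (by simp) (measure_mono_ae ?_)
      filter_upwards [hC.ae_mem_Icc] with u hu hu'
      exact ⟨u, ⟨hu', hu⟩, rfl⟩
    have e3 : freq n (fun k => U k ω) A ≤ freq n (fun k => U k ω) L := by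
      refine freq_mono fun k _ => ?_
      rintro ⟨v, ⟨hv, hvb⟩, hvu⟩
      refine hL ?_ hv
      exact sub_le_iff_le_add.1 (sub_le_of_gridCell_eq hmh (hbω k) hvb hvu.symm)
    have e4 := (abs_lt.1 (hn (gridCell m '' (L' ∩ Set.Icc 0 1)))).1
    linarith
  -- Upper bound: the cells that meet `L` cover it and stay, within the cube, inside `L` raised by
  -- `h`.
  · set A := gridCell m ⁻¹' (gridCell m '' (L ∩ Set.Icc 0 1)) with hA
    have e1 : freq n (fun k => U k ω) L ≤ freq n (fun k => U k ω) A :=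
      freq_mono fun k _ hk => ⟨U k ω, ⟨hk, hbω k⟩, rfl⟩
    have e2 : C.real A ≤ C.real {u | u - (fun _ => h) ∈ L} := by
      refine ENNReal.toReal_mono (by simp) (measure_mono_ae ?_)
      filter_upwards [hC.ae_mem_Icc] with u hu
      rintro ⟨v, ⟨hv, hvb⟩, hvu⟩
      exact hL (sub_le_of_gridCell_eq hmh hu hvb hvu.symm) hv
    have e3 := hshift L hL
    have e4 := (abs_lt.1 (hn (gridCell m '' (L ∩ Set.Icc 0 1)))).2
    linarith

end Copula

/-! ### Quantile transforms and Sklar's relation -/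

section Quantile

variable {d : ℕ} {C μ : Measure (Fin d → ℝ)}

theorem ext_of_Iic_pi {ι : Type*} [Finite ι] {μ ν : Measure (ι → ℝ)} [IsProbabilityMeasure μ]
    [IsProbabilityMeasure ν] (h : ∀ x, μ (Set.Iic x) = ν (Set.Iic x)) : μ = ν := by
  have hspan : IsCountablySpanning (Set.range (Set.Iic : ℝ → Set ℝ)) := by
    refine ⟨fun n : ℕ => Set.Iic (n : ℝ), fun n => ⟨n, rfl⟩, Set.eq_univ_of_forall fun x => ?_⟩
    exact Set.mem_iUnion.2 (exists_nat_ge x)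
  refine ext_of_generate_finite _ (generateFrom_eq_pi
    (fun _ => ((BorelSpace.measurable_eq (α := ℝ)).trans (borel_eq_generateFrom_Iic ℝ)).symm)
    fun _ => hspan).symm (IsPiSystem.pi fun _ => isPiSystem_Iic) ?_ (by simp)
  rintro _ ⟨s, hs, rfl⟩
  choose x hx using fun i => hs i (Set.mem_univ i)
  have : Set.univ.pi s = Set.Iic x := by
    rw [← Set.pi_univ_Iic]
    exact Set.pi_congr rfl fun i _ => (hx i).symm
  rw [this, h]

theorem marginCDF_eq_cdf [IsProbabilityMeasure μ] (i : Fin d) (t : ℝ) :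
    marginCDF μ i t = cdf (μ.map (fun y => y i)) t := by
  have := Measure.isProbabilityMeasure_map (μ := μ) (measurable_pi_apply i).aemeasurable
  rw [cdf_eq_real, map_measureReal_apply (measurable_pi_apply i) measurableSet_Iic]
  rfl

/-- The quantile function of the `i`-th margin, set to `0` outside of `(0, 1)`. -/
noncomputable def marginQuantile (μ : Measure (Fin d → ℝ)) (i : Fin d) (s : ℝ) : ℝ :=
  open Classical in if s ∈ Set.Ioo (0 : ℝ) 1 then sInf {x | s ≤ marginCDF μ i x} else 0

theorem marginQuantile_le_iff [IsProbabilityMeasure μ] (i : Fin d) {s : ℝ}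
    (hs : s ∈ Set.Ioo (0 : ℝ) 1) (x : ℝ) : marginQuantile μ i s ≤ x ↔ s ≤ marginCDF μ i x := by
  have hmeas := Measure.isProbabilityMeasure_map (μ := μ) (measurable_pi_apply i).aemeasurable
  simp only [marginQuantile, if_pos hs, marginCDF_eq_cdf]
  set F := cdf (μ.map (fun y => y i)) with hF
  have hbot : Tendsto F atBot (𝓝 0) := tendsto_cdf_atBot _
  have htop : Tendsto F atTop (𝓝 1) := tendsto_cdf_atTop _
  have hne : {x | s ≤ F x}.Nonempty := by
    obtain ⟨y, hy⟩ := ((tendsto_order.1 htop).1 s hs.2).exists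
    exact ⟨y, hy.le⟩
  have hbdd : BddBelow {x | s ≤ F x} := by
    obtain ⟨y, hy⟩ := ((tendsto_order.1 hbot).2 s hs.1).exists
    refine ⟨y, fun z hz => ?_⟩
    by_contra! hzy
    exact absurd (hz.trans (F.mono hzy.le)) (not_le.2 hy)
  constructor
  · intro h
    -- Right-continuity shows that the infimum defining the quantile is attained, which holds even
    -- when `F` has jumps.
    refine ge_of_tendsto ((F.right_continuous x).mono_left (nhdsWithin_mono _ Set.Ioi_subset_Ici_self))
      (eventually_mem_nhdsWithin.mono fun y hy => ?_)
    obtain ⟨z, hz, hzy⟩ := exists_lt_of_csInf_lt hne (h.trans_lt hy)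
    exact le_trans hz (F.mono hzy.le)
  · exact fun h => csInf_le hbdd h

theorem measurable_marginQuantile [IsProbabilityMeasure μ] (i : Fin d) :
    Measurable (marginQuantile μ i) := by
  refine measurable_of_Iic fun x => ?_
  have : marginQuantile μ i ⁻¹' Set.Iic x = (Set.Ioo 0 1 ∩ Set.Iic (marginCDF μ i x))
      ∪ ((Set.Ioo 0 1)ᶜ ∩ {_s | 0 ≤ x}) := by
    ext s
    by_cases hs : s ∈ Set.Ioo (0 : ℝ) 1
    · have := marginQuantile_le_iff (μ := μ) i hs x
      simp only [Set.mem_preimage, Set.mem_Iic, Set.mem_union, Set.mem_inter_iff,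
        Set.mem_compl_iff, hs, this]
      simp
    · simp only [Set.mem_preimage, Set.mem_Iic, Set.mem_union, Set.mem_inter_iff,
        Set.mem_compl_iff, hs, marginQuantile]
      simp
  rw [this]
  exact (measurableSet_Ioo.inter measurableSet_Iic).union
    (measurableSet_Ioo.compl.inter (MeasurableSet.const _))

theorem IsCopulaOf.map_marginQuantile [IsProbabilityMeasure μ] (hC : IsCopulaOf C μ) :
    C.map (fun u i => marginQuantile μ i (u i)) = μ := by
  have := hC.isCopula.isProbabilityMeasure
  have hm : Measurable (fun (u : Fin d → ℝ) i => marginQuantile μ i (u i)) :=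
    measurable_pi_lambda _ fun i => (measurable_marginQuantile i).comp (measurable_pi_apply i)
  have := Measure.isProbabilityMeasure_map (μ := C) hm.aemeasurable
  refine ext_of_Iic_pi fun x => ?_
  rw [Measure.map_apply hm measurableSet_Iic]
  have h1 : C ((fun u i => marginQuantile μ i (u i)) ⁻¹' Set.Iic x)
      = C {u | ∀ i, u i ≤ marginCDF μ i (x i)} := by
    refine measure_congr ?_
    filter_upwards [hC.isCopula.ae_mem_Ioo] with u hu
    exact propext (forall_congr' fun i => marginQuantile_le_iff i (hu i) (x i))
  rw [h1]
  have h2 := hC.sklar x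
  exact ((ENNReal.toReal_eq_toReal_iff' (by simp) (by simp)).1 h2).symm

/-- The set of all `u` with `Q_1(u_1) + ⋯ + Q_d(u_d) ≤ t`, for the quantile functions `Q_i` of
the margins with values in `[-∞, ∞]`. -/
def sumRegion (μ : Measure (Fin d → ℝ)) (t : ℝ) : Set (Fin d → ℝ) :=
  {u | ∃ x : Fin d → ℝ, ∑ i, x i ≤ t ∧ ∀ i, u i ≤ marginCDF μ i (x i)}

theorem isLowerSet_sumRegion (μ : Measure (Fin d → ℝ)) (t : ℝ) : IsLowerSet (sumRegion μ t) :=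
  fun _ _ hvu ⟨x, hx, hu⟩ => ⟨x, hx, fun i => (hvu i).trans (hu i)⟩

/-- For `u` in the open cube, the quantiles are the smallest admissible witnesses `x`, so membership
reduces to a bound on their sum, whose law comes from `map_marginQuantile`. -/
theorem IsCopulaOf.real_sumRegion [IsProbabilityMeasure μ] (hC : IsCopulaOf C μ) (t : ℝ) :
    C.real (sumRegion μ t) = sumCDF μ t := by
  have hm : Measurable (fun (u : Fin d → ℝ) i => marginQuantile μ i (u i)) :=
    measurable_pi_lambda _ fun i => (measurable_marginQuantile i).comp (measurable_pi_apply i)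
  have hset : MeasurableSet {y : Fin d → ℝ | ∑ i, y i ≤ t} :=
    measurableSet_le (by fun_prop) measurable_const
  have h : C (sumRegion μ t) = μ {y | ∑ i, y i ≤ t} := by
    conv_rhs => rw [← hC.map_marginQuantile]
    rw [Measure.map_apply hm hset]
    refine measure_congr ?_
    filter_upwards [hC.isCopula.ae_mem_Ioo] with u hu
    refine propext ⟨?_, fun h => ?_⟩
    · rintro ⟨x, hx, hxu⟩
      exact (Finset.sum_le_sum fun i _ => (marginQuantile_le_iff i (hu i) (x i)).2 (hxu i)).trans hx
    · exact ⟨_, h, fun i => (marginQuantile_le_iff i (hu i) _).1 le_rfl⟩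
  exact congrArg ENNReal.toReal h

end Quantile

/-! ### Order statistics, ranks and the synthetic sample -/

section Sample

theorem empiricalCDF_eq_freq {E : Type*} {n : ℕ} (f : E → ℝ) (u : ℕ → E) (t : ℝ) :
    empiricalCDF (fun k : Fin n => f (u k)) t = freq n u {v | f v ≤ t} := by
  classical
  simp only [empiricalCDF, freq, Set.indicator_apply, Set.mem_ofPred_eq]
  rw [Fin.sum_univ_eq_sum_range (fun k => if f (u k) ≤ t then (1 : ℝ) else 0), one_div_mul_eq_div]

theorem empiricalCDF_mem_Icc {n : ℕ} (x : Fin n → ℝ) (t : ℝ) :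
    empiricalCDF x t ∈ Set.Icc (0 : ℝ) 1 := by
  have h0 : (0 : ℝ) ≤ ∑ k, if x k ≤ t then 1 else 0 :=
    Finset.sum_nonneg fun k _ => by split_ifs <;> simp
  have h1 : (∑ k, if x k ≤ t then (1 : ℝ) else 0) ≤ n := by
    refine (Finset.sum_le_sum (g := fun _ => (1 : ℝ)) fun k _ => ?_).trans (by simp)
    split_ifs <;> simp
  rw [empiricalCDF, one_div_mul_eq_div]
  exact ⟨by positivity, div_le_one_of_le₀ h1 (by positivity)⟩

theorem marginCDF_mem_Icc {d : ℕ} (μ : Measure (Fin d → ℝ)) [IsProbabilityMeasure μ] (i : Fin d)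
    (t : ℝ) : marginCDF μ i t ∈ Set.Icc (0 : ℝ) 1 :=
  ⟨measureReal_nonneg, measureReal_le_one⟩

theorem supNorm_nonneg (f : ℝ → ℝ) : 0 ≤ supNorm f :=
  Real.iSup_nonneg fun _ => abs_nonneg _

theorem abs_le_supNorm {f : ℝ → ℝ} {c : ℝ} (hf : ∀ t, |f t| ≤ c) (t : ℝ) : |f t| ≤ supNorm f :=
  le_ciSup (f := fun t => |f t|) ⟨c, by rintro _ ⟨t, rfl⟩; exact hf t⟩ t

/-- The `r`-th smallest value is at most `t` iff at least `r` sample values are; ties are harmless.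
The zero-based position `r - 1` turns `<` into `≤`. -/
theorem orderStat_le_iff {n : ℕ} (x : Fin n → ℝ) (r : ℕ) (h₁ : 1 ≤ r) (h₂ : r ≤ n) (t : ℝ) :
    orderStat x r h₁ h₂ ≤ t ↔ (r : ℝ) / n ≤ empiricalCDF x t := by
  have hn : (0 : ℝ) < n := by exact_mod_cast h₁.trans h₂
  have h := Tuple.lt_card_le_iff_apply_le_of_monotone (j := ⟨r - 1, by omega⟩) (a := t)
    (Tuple.monotone_sort x)
  have hcard : Fintype.card {i // (x ∘ Tuple.sort x) i ≤ t} = Fintype.card {i // x i ≤ t} :=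
    Fintype.card_congr ((Tuple.sort x).subtypeEquiv fun i => Iff.rfl)
  rw [← Fintype.card_subtype, hcard] at h
  rw [orderStat, empiricalCDF, one_div_mul_eq_div, div_le_div_iff_of_pos_right hn,
    Finset.sum_boole, Nat.cast_le, ← Fintype.card_subtype]
  refine h.symm.trans ?_
  simp only
  omega

theorem rank_div_eq_freq {d n : ℕ} (u : ℕ → Fin d → ℝ) (i : Fin d) (j : Fin n) :
    (rank (fun k : Fin n => u k i) j : ℝ) / n = freq n u {v | v i ≤ u j i} := by
  rw [← empiricalCDF_eq_freq (fun v : Fin d → ℝ => v i) u, empiricalCDF, one_div_mul_eq_div, rank]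
  push_cast
  rfl

/-- The empirical counterpart of `sumRegion`, with scaled ranks in place of `u j` and empirical
margins in place of `F_i`. -/
theorem sum_syntheticSample_le_iff {d n : ℕ} (x : Fin d → Fin n → ℝ) (u : ℕ → Fin d → ℝ)
    (j : Fin n) (t : ℝ) :
    ∑ i, syntheticSample x (fun k : Fin n => u k) j i ≤ t ↔ ∃ y : Fin d → ℝ, ∑ i, y i ≤ t ∧
      ∀ i, freq n u {v | v i ≤ u j i} ≤ empiricalCDF (x i) (y i) := by
  have key : ∀ i s, syntheticSample x (fun k : Fin n => u k) j i ≤ s ↔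
      freq n u {v | v i ≤ u j i} ≤ empiricalCDF (x i) s := fun i s => by
    rw [syntheticSample, orderStat_le_iff, rank_div_eq_freq]
  constructor
  · exact fun h => ⟨_, h, fun i => (key i _).1 le_rfl⟩
  · rintro ⟨y, hy, h⟩
    exact (Finset.sum_le_sum fun i _ => (key i _).2 (h i)).trans hy

theorem freq_le_sumEstimator {d n : ℕ} (x : Fin d → Fin n → ℝ) (u : ℕ → Fin d → ℝ) (t : ℝ)
    {A : Set (Fin d → ℝ)}
    (h : ∀ j : Fin n, u j ∈ A → ∑ i, syntheticSample x (fun k : Fin n => u k) j i ≤ t) :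
    freq n u A ≤ sumEstimator x (fun k : Fin n => u k) t := by
  classical
  simp only [freq, sumEstimator, empiricalCDF, one_div_mul_eq_div]
  rw [← Fin.sum_univ_eq_sum_range (fun k => A.indicator (fun _ => (1 : ℝ)) (u k))]
  gcongr with j
  by_cases hA : u j ∈ A
  · simp [hA, h j hA]
  · simp only [Set.indicator_of_notMem hA]
    split_ifs <;> simp

theorem sumEstimator_le_freq {d n : ℕ} (x : Fin d → Fin n → ℝ) (u : ℕ → Fin d → ℝ) (t : ℝ)
    {A : Set (Fin d → ℝ)}
    (h : ∀ j : Fin n, ∑ i, syntheticSample x (fun k : Fin n => u k) j i ≤ t → u j ∈ A) :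
    sumEstimator x (fun k : Fin n => u k) t ≤ freq n u A := by
  classical
  simp only [freq, sumEstimator, empiricalCDF, one_div_mul_eq_div]
  rw [← Fin.sum_univ_eq_sum_range (fun k => A.indicator (fun _ => (1 : ℝ)) (u k))]
  gcongr with j
  split_ifs with hj
  · simp [h j hj]
  · exact Set.indicator_nonneg (fun _ _ => zero_le_one) _

end Sample

/-! ### Consistency of the estimator -/

/-- A quantitative form of consistency: if the empirical margins and the empirical frequencies of
lower sets are close to their limits, then so is the estimator. -/
theorem abs_sumEstimator_sub_le {d n : ℕ} {C μ : Measure (Fin d → ℝ)} [IsProbabilityMeasure μ]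
    (hC : IsCopulaOf C μ) {x : Fin d → Fin n → ℝ} {u : ℕ → Fin d → ℝ}
    (hu : ∀ k, u k ∈ Set.Icc 0 1) {h ε η : ℝ} (hε : 2 * ε ≤ h)
    (hshift : ∀ L : Set (Fin d → ℝ), IsLowerSet L →
      C.real {v | v - (fun _ => h) ∈ L} ≤ C.real L + η)
    (hx : ∀ i t, |empiricalCDF (x i) t - marginCDF μ i t| ≤ ε)
    (hfreq : ∀ L : Set (Fin d → ℝ), IsLowerSet L → |freq n u L - C.real L| ≤ min ε η) (t : ℝ) :
    |sumEstimator x (fun k : Fin n => u k) t - sumCDF μ t| ≤ 2 * η := by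
  -- Half-spaces `{v | v i ≤ s}` are lower sets of `C`-mass `s`, so uniform closeness on lower sets
  -- also controls the ranks.
  have hrank : ∀ (j : Fin n) i, |freq n u {v | v i ≤ u j i} - u j i| ≤ ε := fun j i => by
    have h1 := hfreq {v | v i ≤ u j i} fun v w hwv hv => (hwv i).trans hv
    rw [hC.isCopula.real_eval_le i ⟨(hu j).1 i, (hu j).2 i⟩] at h1
    exact h1.trans (min_le_left _ _)
  have hlow := isLowerSet_sumRegion μ t
  have hlow1 : IsLowerSet {v | v - (fun _ => h) ∈ sumRegion μ t} :=
    fun v w hwv hv => hlow (sub_le_sub_right hwv _) hv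
  have hlow2 : IsLowerSet {v | v + (fun _ => h) ∈ sumRegion μ t} :=
    fun v w hwv hv => hlow (add_le_add_left hwv _) hv
  -- One `ε` is lost on the rank and one on the margin, together at most `h`.
  have up := sumEstimator_le_freq x u t (A := {v | v - (fun _ => h) ∈ sumRegion μ t}) fun j hj => by
    obtain ⟨y, hy, hyu⟩ := (sum_syntheticSample_le_iff x u j t).1 hj
    refine ⟨y, hy, fun i => ?_⟩
    have h1 := abs_le.1 (hrank j i)
    have h2 := abs_le.1 (hx i (y i))
    have h3 := hyu i
    simp only [Pi.sub_apply]
    linarith [h1.1, h2.2]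
  have down := freq_le_sumEstimator x u t (A := {v | v + (fun _ => h) ∈ sumRegion μ t}) fun j hj => by
    obtain ⟨y, hy, hyu⟩ := hj
    refine (sum_syntheticSample_le_iff x u j t).2 ⟨y, hy, fun i => ?_⟩
    have h1 := abs_le.1 (hrank j i)
    have h2 := abs_le.1 (hx i (y i))
    have h3 := hyu i
    simp only [Pi.add_apply] at h3
    linarith [h1.2, h2.1]
  have e1 := abs_le.1 ((hfreq _ hlow1).trans (min_le_right _ _))
  have e2 := abs_le.1 ((hfreq _ hlow2).trans (min_le_right _ _))
  have e3 := hshift _ hlow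
  -- Raising the lowered region by `h` gives back `sumRegion μ t`, so the lowered region misses at
  -- most `η` of its mass.
  have e4 := hshift _ hlow2
  have e0 : {v : Fin d → ℝ | v - (fun _ => h) ∈ {v | v + (fun _ => h) ∈ sumRegion μ t}}
      = sumRegion μ t := by ext v; simp
  rw [e0] at e4
  rw [← hC.real_sumRegion t, abs_le]
  constructor <;> linarith [e1.2, e2.1]

end ImanConover

theorem theorem1 {Ω : Type*} [MeasurableSpace Ω] (P : Measure Ω) [IsProbabilityMeasure P]
    {d : ℕ}
    -- the law of the random vector, with an absolutely continuous copula
    (μ : Measure (Fin d → ℝ)) [IsProbabilityMeasure μ]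
    (C : Measure (Fin d → ℝ)) (hC : ImanConover.IsCopulaOf C μ) (hCac : C ≪ volume)
    -- the marginal samples, with arbitrary dependence; the index `k` starts from `0`
    (X : Fin d → ℕ → Ω → ℝ) (hX : ∀ i k, Measurable (X i k))
    -- the simulated i.i.d. sample of the copula; the index `k` starts from `0`
    (U : ℕ → Ω → Fin d → ℝ) (hU : ∀ k, Measurable (U k))
    (hUlaw : ∀ k, P.map (U k) = C) (hUindep : iIndepFun U P)
    -- strong uniform consistency of the empirical margins
    (hF : ∀ i, ∀ᵐ ω ∂P, Tendsto
      (fun n : ℕ => ImanConover.supNorm fun t =>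
        ImanConover.empiricalCDF (fun k : Fin n => X i k ω) t - ImanConover.marginCDF μ i t)
      atTop (𝓝 0)) :
    ∀ᵐ ω ∂P, Tendsto
      (fun n : ℕ => ImanConover.supNorm fun t =>
        ImanConover.sumEstimator (fun i (k : Fin n) => X i k ω) (fun k : Fin n => U k ω) t
          - ImanConover.sumCDF μ t)
      atTop (𝓝 0) := by
  have hbox : ∀ᵐ ω ∂P, ∀ k, U k ω ∈ Set.Icc (0 : Fin d → ℝ) 1 := by
    rw [ae_all_iff]
    intro k
    exact ae_of_ae_map (hU k).aemeasurable (by rw [hUlaw]; exact hC.isCopula.ae_mem_Icc)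
  filter_upwards [ae_all_iff.2 hF, hbox,
    hC.isCopula.glivenkoCantelli hCac hU hUlaw hUindep] with ω hFω hbω hGC
  rw [Metric.tendsto_nhds]
  intro δ hδ
  -- The pathwise bound is then `2 * (δ / 4) = δ / 2`, still strictly below `δ` after the supremum
  -- over `t`.
  have hη : 0 < δ / 4 := by positivity
  obtain ⟨h, h0, hshift⟩ := hC.isCopula.exists_shift hCac hη
  have hmargin : ∀ᶠ n : ℕ in atTop, ∀ i, (ImanConover.supNorm fun t =>
      ImanConover.empiricalCDF (fun k : Fin n => X i k ω) t - ImanConover.marginCDF μ i t)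
        ≤ h / 2 := by
    rw [eventually_all]
    exact fun i => ((tendsto_order.1 (hFω i)).2 _ (half_pos h0)).mono fun _ hn => hn.le
  filter_upwards [hmargin, hGC _ (lt_min (half_pos h0) hη)] with n hn hL
  have hx : ∀ i t, |ImanConover.empiricalCDF (fun k : Fin n => X i k ω) t
      - ImanConover.marginCDF μ i t| ≤ h / 2 := fun i t => by
    -- The bound `1` is needed because a real supremum over an unbounded set defaults to `0`.
    refine le_trans (ImanConover.abs_le_supNorm (c := 1) (f := fun t => ImanConover.empiricalCDF
      (fun k : Fin n => X i k ω) t - ImanConover.marginCDF μ i t) (fun t => ?_) t) (hn i)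
    have h1 := ImanConover.empiricalCDF_mem_Icc (fun k : Fin n => X i k ω) t
    have h2 := ImanConover.marginCDF_mem_Icc μ i t
    rw [abs_le]
    constructor <;> linarith [h1.1, h1.2, h2.1, h2.2]
  have hmain := ImanConover.abs_sumEstimator_sub_le hC (u := fun k => U k ω) hbω
    (by linarith : 2 * (h / 2) ≤ h) hshift hx hL
  rw [Real.dist_eq, sub_zero, abs_of_nonneg (ImanConover.supNorm_nonneg _)]
  exact (ciSup_le hmain).trans_lt (by linarith)
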